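/- Let $S$ be a commutative semiring (with $0$ and $1$), and for $n\in\mathbb{N}=\{0,1,2,\dots\}$ write $n$ also for the sum of $n$ ones in $S$. Let $\leqslant$ be a Strassen preorder on $S$, that is, a reflexive and transitive relation such that 1. for all $n,m\in\mathbb{N}$: $n\le m$ in $\mathbb{N}$ if and only if $n\leqslant m$ in $S$; 2. for all $a,b,c,d\in S$: if $a\leqslant b$ and $c\leqslant d$, then $a+c\leqslant b+d$ and $ac\leqslant bd$; 3. for all $a,b\in S$ with $b\neq 0$ there is an $r\in\mathbb{N}$ with $a\leqslant rb$. Let $\mathbf{X}(S)$ be the set of semiring homomorphisms $\phi\colon S\to\mathbb{R}_{\ge 0}$ such that $\phi(a)\le\phi(b)$ whenever $a\leqslant b$. For $a\in S$ let $\mathrm{rank}(a)=\min\{r\in\mathbb{N}: a\leqslant r\}$ and $\mathrm{subrank}(a)=\max\{s\in\mathbb{N}: s\leqslant a\}$. (i) If $a\in S$ satisfies $1\leqslant a$ and $2\leqslant a^k$ for some $k\in\mathbb{N}$, then the limit below exists, the minimum is attained, and $$\lim_{N\to\infty}\mathrm{subrank}(a^N)^{1/N}=\min_{\phi\in\mathbf{X}(S)}\phi(a).$$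 (ii) If $a\in S$ satisfies $1\leqslant a$, then the limit below exists, the maximum is attained, and $$\lim_{N\to\infty}\mathrm{rank}(a^N)^{1/N}=\max_{\phi\in\mathbf{X}(S)}\phi(a).$$ -/

import Mathlib

open Filter Topology

namespace StrassenPreorder

/-- A Strassen preorder on a commutative semiring `S`: a preorder `le` which restricts to the
usual order on the natural numbers of `S`, is compatible with sums and products, and is such that
every element is dominated by a natural multiple of any given nonzero element. -/
structure IsStrassenPreorder {S : Type*} [CommSemiring S] (le : S → S → Prop) : Prop where
  refl : ∀ a : S, le a a
  trans : ∀ a b c : S, le a b → le b c → le a c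
  natCast_iff : ∀ n m : ℕ, n ≤ m ↔ le (n : S) (m : S)
  add : ∀ a b c d : S, le a b → le c d → le (a + c) (b + d)
  mul : ∀ a b c d : S, le a b → le c d → le (a * c) (b * d)
  exists_nat : ∀ a b : S, b ≠ 0 → ∃ r : ℕ, le a ((r : S) * b)

/-- The asymptotic spectrum: the monotone semiring homomorphisms to the nonnegative reals. -/
def spectrum {S : Type*} [CommSemiring S] (le : S → S → Prop) : Set (S →+* NNReal) :=
  {φ | ∀ a b : S, le a b → φ a ≤ φ b}

/-- The rank of `a`: the least natural number above `a`. -/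
noncomputable def rank {S : Type*} [CommSemiring S] (le : S → S → Prop) (a : S) : ℕ :=
  sInf {r : ℕ | le a (r : S)}

/-- The subrank of `a`: the greatest natural number below `a`. -/
noncomputable def subrank {S : Type*} [CommSemiring S] (le : S → S → Prop) (a : S) : ℕ :=
  sSup {s : ℕ | le (s : S) a}

/-- The minimum in the definition of the rank is attained. -/
theorem IsStrassenPreorder.isLeast_rank {S : Type*} [CommSemiring S] {le : S → S → Prop}
    (h : IsStrassenPreorder le) (a : S) : IsLeast {r : ℕ | le a (r : S)} (rank le a) := by
  have h10 : (1 : S) ≠ 0 := by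
    intro h0
    have h1 := (h.natCast_iff 1 0).2 (by simpa [h0] using h.refl 0)
    omega
  obtain ⟨r, hr⟩ := h.exists_nat a 1 h10
  exact ⟨Nat.sInf_mem (s := {r : ℕ | le a (r : S)}) ⟨r, by simpa using hr⟩,
    fun _ hs => Nat.sInf_le hs⟩

/-- The maximum in the definition of the subrank is attained. -/
theorem IsStrassenPreorder.isGreatest_subrank {S : Type*} [CommSemiring S] {le : S → S → Prop}
    (h : IsStrassenPreorder le) (a : S) :
    IsGreatest {s : ℕ | le (s : S) a} (subrank le a) := by
  have hne : {s : ℕ | le (s : S) a}.Nonempty := by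
    refine ⟨0, ?_⟩
    have h01 := (h.natCast_iff 0 1).1 (by omega)
    simpa using h.mul _ _ a a h01 (h.refl a)
  have hb : BddAbove {s : ℕ | le (s : S) a} :=
    ⟨rank le a, fun s hs =>
      (h.natCast_iff s (rank le a)).2 (h.trans _ _ _ hs (h.isLeast_rank a).1)⟩
  exact ⟨Nat.sSup_mem hne hb, fun _ hs => le_csSup hb hs⟩

/-- The asymptotic rank: the limit of the `N`-th roots of the ranks of the powers `a ^ N`. -/
noncomputable def asympRank {S : Type*} [CommSemiring S] (le : S → S → Prop) (a : S) : ℝ :=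
  limUnder atTop (fun N : ℕ => (rank le (a ^ N) : ℝ) ^ (1 / (N : ℝ)))

/-- The asymptotic subrank: the limit of the `N`-th roots of the subranks of the powers `a ^ N`. -/
noncomputable def asympSubrank {S : Type*} [CommSemiring S] (le : S → S → Prop) (a : S) : ℝ :=
  limUnder atTop (fun N : ℕ => (subrank le (a ^ N) : ℝ) ^ (1 / (N : ℝ)))

end StrassenPreorder

/-! Everything rests on a duality, `exists_mem_spectrum_le`: if `v` is not asymptotically below `u`,
some spectral point has `φ u ≤ φ v`. To find it, force `u` below `v`. By `asympLE_of_add_le` this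
can spoil the order on ℕ only if `v` is asymptotically below `u`. Zorn's lemma then enlarges the
preorder to a maximal one, in which any failure of `u ≤ v` makes `v` asymptotically below `u`. There
the rational bounds of each element from above and below meet (`value_eq_sSup`), and the common
value is a monotone homomorphism.

Fekete's lemma gives the limits `R` of rank and `Q` of subrank, and monotonicity gives `Q ≤ φ a ≤
R`. Conversely, an integer strictly between `r ^ N` and `R ^ N` cannot asymptotically dominate `a ^
N`, so duality yields `φ a ≥ r`. The case of `Q` is symmetric, with `2 ≤ a ^ k` absorbing the factor
`2 ^ M`. Compactness of the spectrum gives attainment. -/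

namespace StrassenPreorder

/-! ### Asymptotic domination and forcing one inequality -/

/-- Asymptotic domination: `x ≤ y` up to a factor growing subexponentially in the exponent. -/
def AsympLE {S : Type*} [CommSemiring S] (le : S → S → Prop) (x y : S) : Prop :=
  ∀ T : ℕ, ∃ M : ℕ, 0 < M ∧ le (x ^ (M * T)) (2 ^ M * y ^ (M * T))

/-- The relation obtained from `le` by forcing `u` to be below `v`. -/
def extension {S : Type*} [CommSemiring S] (le : S → S → Prop) (u v : S) (x y : S) : Prop :=
  ∃ s : S, le (x + s * v) (y + s * u)

/-- Makes a linear loss `j + 1` at `j = T * l` subexponential, with a spare factor 2 to absorb a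
constant. -/
theorem exists_mul_add_one_le_two_pow (T : ℕ) : ∃ l : ℕ, 0 < l ∧ 2 * (T * l + 1) ≤ 2 ^ l := by
  refine ⟨2 * T + 6, by omega, ?_⟩
  have key : ∀ T : ℕ, 2 * (T * (2 * T + 6) + 1) + 16 ≤ 2 ^ (2 * T + 6) := by
    intro T
    induction T with
    | zero => norm_num
    | succ n ih =>
      have : 2 ^ (2 * (n + 1) + 6) = 4 * 2 ^ (2 * n + 6) := by ring
      rw [this]
      nlinarith
  exact (Nat.le_add_right _ _).trans (key T)

namespace IsStrassenPreorder

variable {S : Type*} [CommSemiring S] {le : S → S → Prop}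

theorem natCast_le (h : IsStrassenPreorder le) {n m : ℕ} (hnm : n ≤ m) : le (n : S) (m : S) :=
  (h.natCast_iff n m).1 hnm

theorem zero_le (h : IsStrassenPreorder le) (a : S) : le 0 a := by
  simpa using h.mul _ _ a a (h.natCast_le (Nat.zero_le 1)) (h.refl a)

theorem mul_left (h : IsStrassenPreorder le) {a b : S} (hab : le a b) (c : S) :
    le (c * a) (c * b) :=
  h.mul _ _ _ _ (h.refl c) hab

theorem mul_right (h : IsStrassenPreorder le) {a b : S} (hab : le a b) (c : S) :
    le (a * c) (b * c) :=
  h.mul _ _ _ _ hab (h.refl c)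

theorem add_right (h : IsStrassenPreorder le) {a b : S} (hab : le a b) (c : S) :
    le (a + c) (b + c) :=
  h.add _ _ _ _ hab (h.refl c)

theorem le_add_right (h : IsStrassenPreorder le) (a b : S) : le a (a + b) := by
  simpa using h.add _ _ _ _ (h.refl a) (h.zero_le b)

theorem le_add_left (h : IsStrassenPreorder le) (a b : S) : le a (b + a) := by
  simpa using h.add _ _ _ _ (h.zero_le b) (h.refl a)

theorem pow (h : IsStrassenPreorder le) {a b : S} (hab : le a b) (n : ℕ) :
    le (a ^ n) (b ^ n) := by
  induction n with
  | zero => simpa using h.refl 1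
  | succ n ih => simpa [pow_succ] using h.mul _ _ _ _ ih hab

theorem mul_add_le_of_add_le (h : IsStrassenPreorder le) {x y c : S} (hxy : le (x + c) (y + c))
    (N : ℕ) : le (N * x + c) (N * y + c) := by
  induction N with
  | zero => simpa using h.refl c
  | succ n ih =>
    have h1 := h.add _ _ _ _ (h.refl x) ih
    have h2 := h.add _ _ _ _ (h.refl ((n : S) * y)) hxy
    have e1 : ((n + 1 : ℕ) : S) * x + c = x + (n * x + c) := by push_cast; ring
    have e2 : x + (n * y + c) = n * y + (x + c) := by ring
    have e3 : ((n + 1 : ℕ) : S) * y + c = n * y + (y + c) := by push_cast; ring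
    rw [e1, e3]
    rw [e2] at h1
    exact h.trans _ _ _ h1 h2

/-- A common nonzero factor can be cancelled at the cost of a constant. -/
theorem exists_pow_le_of_mul_le (h : IsStrassenPreorder le) {t x y : S} (ht : t ≠ 0)
    (hxy : le (t * x) (t * y)) : ∃ C : ℕ, ∀ N : ℕ, le (x ^ N) (C * y ^ N) := by
  obtain ⟨r, hr⟩ := h.exists_nat 1 t ht
  have ind : ∀ N : ℕ, le (t * x ^ N) (t * y ^ N) := by
    intro N
    induction N with
    | zero => simpa using h.refl t
    | succ n ih =>
      have h1 := h.mul_right ih x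
      have h2 := h.mul_right hxy (y ^ n)
      have e1 : t * x ^ (n + 1) = t * x ^ n * x := by ring
      have e2 : t * y ^ n * x = t * x * y ^ n := by ring
      have e3 : t * y ^ (n + 1) = t * y * y ^ n := by ring
      rw [e1, e3]
      rw [e2] at h1
      exact h.trans _ _ _ h1 h2
  -- Sandwich `t` between constants: `1 ≤ r * t` and `t ≤ rank t`.
  refine ⟨r * rank le t, fun N => ?_⟩
  have h1 := h.mul_right hr (x ^ N)
  have h2 := h.mul_left (ind N) (r : S)
  have h3 := h.mul_left (h.mul_right (h.isLeast_rank t).1 (y ^ N)) (r : S)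
  rw [one_mul, mul_assoc] at h1
  push_cast
  rw [mul_assoc]
  exact h.trans _ _ _ h1 (h.trans _ _ _ h2 h3)

/-- A failure of strictness in the extension yields an asymptotic inequality. -/
theorem asympLE_of_add_le (h : IsStrassenPreorder le) {u v s : S} {m : ℕ}
    (hm : le (m + 1 + s * v) (m + s * u)) : AsympLE le v u := by
  have hsu : s * u ≠ 0 := by
    intro h0
    rw [h0, add_zero] at hm
    have h1 := h.trans _ _ _ (h.le_add_right ((m : S) + 1) (s * v)) hm
    have h2 := (h.natCast_iff (m + 1) m).2 (by exact_mod_cast h1)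
    omega
  have hs : s ≠ 0 := by
    rintro rfl
    simp at hsu
  obtain ⟨k', hk'⟩ := h.exists_nat (m : S) (s * u) hsu
  -- Positivity of `k` keeps the factor `k ^ j * j!` nonzero, so that it can be cancelled later.
  obtain ⟨k, hk0, hk⟩ : ∃ k : ℕ, 0 < k ∧ le (m : S) (k * (s * u)) :=
    ⟨k' + 1, by omega, h.trans _ _ _ hk' (h.mul_right (h.natCast_le (by omega)) _)⟩
  have hlin : ∀ N : ℕ, le (N * (s * v)) ((N + k : ℕ) * (s * u)) := by
    intro N
    have h0 : le ((1 + s * v) + m) (s * u + m) := by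
      have e1 : (1 + s * v) + m = m + 1 + s * v := by ring
      rw [e1, add_comm (s * u)]
      exact hm
    have h1 := h.mul_add_le_of_add_le h0 N
    have h2 := h.mul_left (h.le_add_left (s * v) 1) (N : S)
    have h3 := h.trans _ _ _ h2 (h.le_add_right ((N : S) * (1 + s * v)) m)
    have h4 := h.add _ _ _ _ (h.refl ((N : S) * (s * u))) hk
    rw [← add_mul] at h4
    push_cast
    exact h.trans _ _ _ h3 (h.trans _ _ _ h1 h4)
  -- Multiply `hlin` over `N = k * (i + 1)`, `i < j`: the ratios `(i + 2) / (i + 1)` telescope, so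
  -- the loss is only `j + 1`.
  have hprod : ∀ j : ℕ, le ((s * ((k ^ j * j.factorial : ℕ) : S)) * v ^ j)
      ((s * ((k ^ j * j.factorial : ℕ) : S)) * ((j + 1 : ℕ) * u ^ j)) := by
    intro j
    induction j with
    | zero => simpa using h.refl s
    | succ j ih =>
      have h1 := h.mul_right ih (((k * (j + 1) : ℕ) : S) * v)
      have h2 := h.mul_left (hlin (k * (j + 1))) (((k ^ j * (j + 1).factorial : ℕ) : S) * u ^ j)
      have e1 : (s * ((k ^ (j + 1) * (j + 1).factorial : ℕ) : S)) * v ^ (j + 1) =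
          (s * ((k ^ j * j.factorial : ℕ) : S)) * v ^ j * (((k * (j + 1) : ℕ) : S) * v) := by
        rw [Nat.factorial_succ]; push_cast; ring
      have e2 : (s * ((k ^ j * j.factorial : ℕ) : S)) * ((j + 1 : ℕ) * u ^ j) *
            (((k * (j + 1) : ℕ) : S) * v) =
          (((k ^ j * (j + 1).factorial : ℕ) : S) * u ^ j) *
            (((k * (j + 1) : ℕ) : S) * (s * v)) := by
        rw [Nat.factorial_succ]; push_cast; ring
      have e3 : (s * ((k ^ (j + 1) * (j + 1).factorial : ℕ) : S)) *
            ((j + 1 + 1 : ℕ) * u ^ (j + 1)) =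
          (((k ^ j * (j + 1).factorial : ℕ) : S) * u ^ j) *
            (((k * (j + 1) + k : ℕ) : S) * (s * u)) := by
        rw [Nat.factorial_succ]; push_cast; ring
      rw [e1, e3]
      rw [e2] at h1
      exact h.trans _ _ _ h1 h2
  intro T
  obtain ⟨l, hl0, hl⟩ := exists_mul_add_one_le_two_pow T
  have ht : s * ((k ^ (T * l) * (T * l).factorial : ℕ) : S) ≠ 0 := by
    intro h0
    obtain ⟨r, hr⟩ := h.exists_nat 1 s hs
    have hpos : 1 ≤ k ^ (T * l) * (T * l).factorial :=
      Nat.mul_pos (pow_pos hk0 _) (Nat.factorial_pos _)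
    have h1 := h.mul _ _ _ _ hr (h.natCast_le hpos)
    rw [mul_assoc, h0, mul_zero] at h1
    have h2 := (h.natCast_iff 1 0).2 (by simpa using h1)
    omega
  obtain ⟨C, hC⟩ := h.exists_pow_le_of_mul_le ht (hprod (T * l))
  -- The power `C + 1` is chosen because `C ≤ 2 ^ (C + 1)`, which the spare factor 2 in `hl` pays
  -- for.
  refine ⟨l * (C + 1), by positivity, ?_⟩
  have h1 := hC (C + 1)
  have hnat : C * (T * l + 1) ^ (C + 1) ≤ 2 ^ (l * (C + 1)) := by
    calc C * (T * l + 1) ^ (C + 1) ≤ 2 ^ (C + 1) * (T * l + 1) ^ (C + 1) := by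
          gcongr
          exact (Nat.lt_two_pow_self.le).trans (Nat.pow_le_pow_right (by norm_num) (by omega))
      _ = (2 * (T * l + 1)) ^ (C + 1) := by rw [mul_pow]
      _ ≤ (2 ^ l) ^ (C + 1) := by gcongr
      _ = 2 ^ (l * (C + 1)) := by rw [pow_mul]
  have h2 := h.mul_right (h.natCast_le hnat) (u ^ (l * (C + 1) * T))
  have e1 : v ^ (l * (C + 1) * T) = (v ^ (T * l)) ^ (C + 1) := by
    rw [← pow_mul]; congr 1; ring
  have e2 : (C : S) * (((T * l + 1 : ℕ) : S) * u ^ (T * l)) ^ (C + 1) =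
      ((C * (T * l + 1) ^ (C + 1) : ℕ) : S) * u ^ (l * (C + 1) * T) := by
    have e : l * (C + 1) * T = T * l * (C + 1) := by ring
    rw [mul_pow, ← pow_mul, e, ← mul_assoc]
    push_cast
    rfl
  rw [e2] at h1
  rw [e1]
  push_cast at h1 h2 ⊢
  exact h.trans _ _ _ h1 h2

theorem le_extension {u v x y : S} (hxy : le x y) :
    extension le u v x y :=
  ⟨0, by simpa using hxy⟩

theorem extension_self (h : IsStrassenPreorder le) (u v : S) : extension le u v u v :=
  ⟨1, by simpa [add_comm] using h.refl (u + v)⟩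

/-- Only the order on ℕ is at risk: a relation `n ≤ m` with `m < n` would give the hypothesis of
`asympLE_of_add_le`. -/
theorem extension_isStrassenPreorder (h : IsStrassenPreorder le) {u v : S}
    (hvu : ¬ AsympLE le v u) : IsStrassenPreorder (extension le u v) := by
  have htrans : ∀ a b c : S, extension le u v a b → extension le u v b c →
      extension le u v a c := by
    rintro a b c ⟨s, hs⟩ ⟨t, ht⟩
    refine ⟨s + t, ?_⟩
    have h1 := h.add_right hs (t * v)
    have h2 := h.add_right ht (s * u)
    have e1 : a + (s + t) * v = a + s * v + t * v := by ring
    have e2 : b + s * u + t * v = b + t * v + s * u := by ring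
    have e3 : c + (s + t) * u = c + t * u + s * u := by ring
    rw [e1, e3]
    rw [e2] at h1
    exact h.trans _ _ _ h1 h2
  have hmul : ∀ a b c : S, extension le u v a b → extension le u v (a * c) (b * c) := by
    rintro a b c ⟨s, hs⟩
    refine ⟨s * c, ?_⟩
    have h1 := h.mul_right hs c
    have e1 : a * c + s * c * v = (a + s * v) * c := by ring
    have e2 : b * c + s * c * u = (b + s * u) * c := by ring
    rwa [e1, e2]
  refine ⟨fun a => le_extension (h.refl a), htrans, fun n m => ⟨fun hnm =>
    le_extension (h.natCast_le hnm), ?_⟩, ?_, ?_, ?_⟩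
  · rintro ⟨s, hs⟩
    by_contra hlt
    refine hvu (h.asympLE_of_add_le (m := m) (s := s) ?_)
    refine h.trans _ _ _ (h.add_right ?_ _) hs
    exact_mod_cast h.natCast_le (S := S) (show m + 1 ≤ n by omega)
  · rintro a b c d ⟨s, hs⟩ ⟨t, ht⟩
    refine ⟨s + t, ?_⟩
    have h1 := h.add _ _ _ _ hs ht
    have e1 : a + c + (s + t) * v = a + s * v + (c + t * v) := by ring
    have e2 : b + d + (s + t) * u = b + s * u + (d + t * u) := by ring
    rwa [e1, e2]
  · intro a b c d hab hcd
    refine htrans _ _ _ (hmul a b c hab) ?_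
    rw [mul_comm b c, mul_comm b d]
    exact hmul c d b hcd
  · intro a b hb
    obtain ⟨r, hr⟩ := h.exists_nat a b hb
    exact ⟨r, le_extension hr⟩

/-! ### Maximal Strassen preorders -/

/-- Every Strassen preorder is contained in a maximal one. -/
theorem exists_maximal (h : IsStrassenPreorder le) :
    ∃ P : S → S → Prop, le ≤ P ∧ Maximal (· ∈ {P : S → S → Prop | IsStrassenPreorder P}) P := by
  refine zorn_le_nonempty₀ _ ?_ le h
  intro c hc hchain P₀ hP₀
  have hdir : ∀ {P Q}, P ∈ c → Q ∈ c → ∃ R ∈ c, P ≤ R ∧ Q ≤ R := by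
    intro P Q hP hQ
    rcases hchain.total hP hQ with hPQ | hPQ
    · exact ⟨Q, hQ, hPQ, le_rfl⟩
    · exact ⟨P, hP, le_rfl, hPQ⟩
  refine ⟨fun x y => ∃ P ∈ c, P x y, ?_, fun P hP x y hxy => ⟨P, hP, hxy⟩⟩
  refine ⟨fun a => ⟨P₀, hP₀, (hc hP₀).refl a⟩, ?_, fun n m => ⟨fun hnm =>
    ⟨P₀, hP₀, (hc hP₀).natCast_le hnm⟩, ?_⟩, ?_, ?_, ?_⟩
  · rintro x y z ⟨P, hP, hxy⟩ ⟨Q, hQ, hyz⟩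
    obtain ⟨R, hR, hPR, hQR⟩ := hdir hP hQ
    exact ⟨R, hR, (hc hR).trans _ _ _ (hPR _ _ hxy) (hQR _ _ hyz)⟩
  · rintro ⟨P, hP, hnm⟩
    exact ((hc hP).natCast_iff n m).2 hnm
  · rintro x y z w ⟨P, hP, hxy⟩ ⟨Q, hQ, hzw⟩
    obtain ⟨R, hR, hPR, hQR⟩ := hdir hP hQ
    exact ⟨R, hR, (hc hR).add _ _ _ _ (hPR _ _ hxy) (hQR _ _ hzw)⟩
  · rintro x y z w ⟨P, hP, hxy⟩ ⟨Q, hQ, hzw⟩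
    obtain ⟨R, hR, hPR, hQR⟩ := hdir hP hQ
    exact ⟨R, hR, (hc hR).mul _ _ _ _ (hPR _ _ hxy) (hQR _ _ hzw)⟩
  · intro a b hb
    obtain ⟨r, hr⟩ := (hc hP₀).exists_nat a b hb
    exact ⟨r, P₀, hP₀, hr⟩

/-- Otherwise the extension forcing `u` below `v` would be a Strassen preorder, and by maximality
would add nothing. -/
theorem le_or_asympLE_of_maximal
    (hmax : Maximal (· ∈ {P : S → S → Prop | IsStrassenPreorder P}) le) (u v : S) :
    le u v ∨ AsympLE le v u := by
  have h : IsStrassenPreorder le := hmax.prop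
  by_contra! hcon
  exact hcon.1 (hmax.2 (h.extension_isStrassenPreorder hcon.2)
    (fun _ _ hxy => le_extension hxy) _ _ (h.extension_self u v))

end IsStrassenPreorder

/-! ### The homomorphism attached to an asymptotically total preorder -/

/-- The fractions `p / q` with `q * x` below `p`. -/
def upperFractions {S : Type*} [CommSemiring S] (le : S → S → Prop) (x : S) : Set NNReal :=
  {c | ∃ p q : ℕ, 0 < q ∧ le (q * x) p ∧ c = p / q}

/-- The fractions `p / q` with `p` below `q * x`. -/
def lowerFractions {S : Type*} [CommSemiring S] (le : S → S → Prop) (x : S) : Set NNReal :=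
  {c | ∃ p q : ℕ, 0 < q ∧ le (p : S) (q * x) ∧ c = p / q}

/-- The infimum of the fractions above `x`. -/
noncomputable def value {S : Type*} [CommSemiring S] (le : S → S → Prop) (x : S) : NNReal :=
  sInf (upperFractions le x)

theorem le_of_forall_pow_le_mul_pow {x y C : ℝ} (hy : 0 < y)
    (hxy : ∀ T : ℕ, x ^ T ≤ C * y ^ T) : x ≤ y := by
  by_contra! hlt
  obtain ⟨T, hT⟩ := pow_unbounded_of_one_lt C ((one_lt_div hy).2 hlt)
  rw [div_pow, lt_div_iff₀ (by positivity)] at hT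
  exact absurd (hxy T) (not_le.2 hT)

theorem le_of_forall_nat_pow_le_mul_pow {x y C : ℕ}
    (hxy : ∀ T : ℕ, x ^ T ≤ C * y ^ T) : x ≤ y := by
  rcases Nat.eq_zero_or_pos y with rfl | hy
  · simpa using hxy 1
  · exact_mod_cast le_of_forall_pow_le_mul_pow (x := x) (y := y) (C := C) (by exact_mod_cast hy)
      (fun T => by exact_mod_cast hxy T)

namespace IsStrassenPreorder

variable {S : Type*} [CommSemiring S] {le : S → S → Prop}

theorem rank_mem_upperFractions (h : IsStrassenPreorder le) (x : S) :
    (rank le x : NNReal) ∈ upperFractions le x :=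
  ⟨rank le x, 1, one_pos, by simpa using (h.isLeast_rank x).1, by simp⟩

theorem zero_mem_lowerFractions (h : IsStrassenPreorder le) (x : S) :
    (0 : NNReal) ∈ lowerFractions le x :=
  ⟨0, 1, one_pos, by simpa using h.zero_le x, by simp⟩

theorem upperFractions_nonempty (h : IsStrassenPreorder le) (x : S) :
    (upperFractions le x).Nonempty :=
  ⟨_, h.rank_mem_upperFractions x⟩

theorem lower_le_upper (h : IsStrassenPreorder le) {x : S} {l u : NNReal}
    (hl : l ∈ lowerFractions le x) (hu : u ∈ upperFractions le x) : l ≤ u := by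
  obtain ⟨p, q, hq, hpq, rfl⟩ := hl
  obtain ⟨p', q', hq', hpq', rfl⟩ := hu
  have h1 := h.mul_left hpq (q' : S)
  have h2 := h.mul_left hpq' (q : S)
  rw [mul_left_comm] at h2
  have h3 := h.trans _ _ _ h1 h2
  have h4 := (h.natCast_iff (q' * p) (q * p')).2 (by exact_mod_cast h3)
  rw [div_le_div_iff₀ (by exact_mod_cast hq) (by exact_mod_cast hq')]
  norm_cast
  linarith [mul_comm q' p, mul_comm q p']

theorem bddAbove_lowerFractions (h : IsStrassenPreorder le) (x : S) :
    BddAbove (lowerFractions le x) :=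
  ⟨_, fun _ hl => h.lower_le_upper hl (h.rank_mem_upperFractions x)⟩

theorem value_le {x : S} {u : NNReal} (hu : u ∈ upperFractions le x) :
    value le x ≤ u :=
  csInf_le (OrderBot.bddBelow _) hu

/-- Two fractions `p / q < p' / q'` in a gap would, by totality, give `q * x` asymptotically below
`p` and `p'` asymptotically below `q' * x`, hence `p' * q ≤ p * q'`. -/
theorem value_eq_sSup (h : IsStrassenPreorder le) (htot : ∀ u v : S, le u v ∨ AsympLE le v u)
    (x : S) : value le x = sSup (lowerFractions le x) := by
  refine le_antisymm ?_ (csSup_le ⟨_, h.zero_mem_lowerFractions x⟩ fun l hl =>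
    le_csInf (h.upperFractions_nonempty x) fun u hu => h.lower_le_upper hl hu)
  by_contra! hlt
  have aux : ∀ a b : NNReal, a < b → ∃ p q : ℕ, 0 < q ∧ a < p / q ∧ (p / q : NNReal) < b := by
    intro a b hab
    obtain ⟨c, hc, hacb⟩ := (NNReal.lt_iff_exists_rat_btwn a b).1 hab
    have e : Real.toNNReal (c : ℝ) = (c.num.toNat : NNReal) / c.den := by
      apply NNReal.eq
      have h1 : ((c.num.toNat : ℤ) : ℝ) = c.num := by
        rw [Int.toNat_of_nonneg (Rat.num_nonneg.2 hc)]
      rw [Real.coe_toNNReal _ (by exact_mod_cast hc)]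
      push_cast at h1 ⊢
      rw [h1]
      exact_mod_cast (Rat.num_div_den c).symm
    rw [e] at hacb
    exact ⟨_, _, c.den_pos, hacb⟩
  obtain ⟨p, q, hq, hp1, hp2⟩ := aux _ _ hlt
  obtain ⟨p', q', hq', hp1', hp2'⟩ := aux _ _ hp2
  have hn1 : ¬ le (p : S) (q * x) := fun hle =>
    absurd (le_csSup (h.bddAbove_lowerFractions x) ⟨p, q, hq, hle, rfl⟩) (not_le.2 hp1)
  have hn2 : ¬ le (q' * x) (p' : S) := fun hle =>
    absurd (value_le ⟨p', q', hq', hle, rfl⟩) (not_le.2 hp2')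
  have ha1 := (htot _ _).resolve_left hn1
  have ha2 := (htot _ _).resolve_left hn2
  rw [div_lt_div_iff₀ (by exact_mod_cast hq) (by exact_mod_cast hq')] at hp1'
  have hlt : p * q' < p' * q := by exact_mod_cast hp1'
  -- Each of the two asymptotic inequalities costs `2 ^ (M * M')` once the exponents are matched;
  -- together `4 ^ (M * M')`, whose root is 4.
  refine absurd (le_of_forall_nat_pow_le_mul_pow (C := 4) fun T => ?_) (not_le.2 hlt)
  obtain ⟨M, hM, h1⟩ := ha1 T
  obtain ⟨M', hM', h2⟩ := ha2 T
  have h3 := h.mul_left (h.pow h1 M') ((q' : S) ^ (M * M' * T))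
  have h4 := h.mul_left (h.pow h2 M) ((q : S) ^ (M * M' * T))
  have h5 := h.mul_left h3 ((2 : S) ^ (M * M'))
  have e1 : (q : S) ^ (M * M' * T) * ((p' : S) ^ (M' * T)) ^ M =
      ((p' * q) ^ (M * M' * T) : ℕ) := by
    push_cast
    ring
  have e2 : (q : S) ^ (M * M' * T) * (2 ^ M' * ((q' : S) * x) ^ (M' * T)) ^ M =
      2 ^ (M * M') * ((q' : S) ^ (M * M' * T) * (((q : S) * x) ^ (M * T)) ^ M') := by
    ring
  have e3 : (2 : S) ^ (M * M') * ((q' : S) ^ (M * M' * T) * (2 ^ M * (p : S) ^ (M * T)) ^ M') =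
      (4 ^ (M * M') * (p * q') ^ (M * M' * T) : ℕ) := by
    have h4 : (4 : S) = 2 ^ 2 := by norm_num
    push_cast
    rw [h4, ← pow_mul]
    ring
  rw [e1, e2] at h4
  rw [e3] at h5
  have h6 := (h.natCast_iff _ _).2 (h.trans _ _ _ h4 h5)
  rw [mul_comm (M * M') T, pow_mul, pow_mul (p * q'), ← mul_pow] at h6
  exact (Nat.pow_le_pow_iff_left (by positivity)).1 h6

/-- A Strassen preorder that is total up to asymptotic domination is represented by a point of
its spectrum. -/
theorem exists_mem_spectrum_of_total (h : IsStrassenPreorder le)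
    (htot : ∀ u v : S, le u v ∨ AsympLE le v u) : ∃ φ : S →+* NNReal, φ ∈ spectrum le := by
  have hlow : ∀ {x : S} {l : NNReal}, l ∈ lowerFractions le x → l ≤ value le x := by
    intro x l hl
    rw [h.value_eq_sSup htot]
    exact le_csSup (h.bddAbove_lowerFractions x) hl
  have hmono : ∀ a b : S, le a b → value le a ≤ value le b := by
    intro a b hab
    refine le_csInf (h.upperFractions_nonempty b) ?_
    rintro _ ⟨p, q, hq, hpq, rfl⟩
    exact value_le ⟨p, q, hq, h.trans _ _ _ (h.mul_left hab _) hpq, rfl⟩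
  have hnat : ∀ n : ℕ, value le (n : S) = n := fun n =>
    le_antisymm (value_le ⟨n, 1, one_pos, by simpa using h.refl (n : S), by simp⟩)
      (hlow ⟨n, 1, one_pos, by simpa using h.refl (n : S), by simp⟩)
  have frac_mul : ∀ p q p' q' : ℕ, (p / q : NNReal) * (p' / q') = (p * p' : ℕ) / (q * q' : ℕ) := by
    intro p q p' q'
    push_cast
    rw [div_mul_div_comm]
  have frac_add : ∀ p q p' q' : ℕ, 0 < q → 0 < q' →
      (p / q : NNReal) + p' / q' = (p * q' + q * p' : ℕ) / (q * q' : ℕ) := by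
    intro p q p' q' hq hq'
    push_cast
    rw [div_add_div _ _ (by exact_mod_cast hq.ne') (by exact_mod_cast hq'.ne')]
  have hadd : ∀ a b : S, value le (a + b) = value le a + value le b := by
    intro a b
    -- Upper fractions give subadditivity, lower fractions superadditivity; likewise for products.
    apply le_antisymm
    · have := (h.upperFractions_nonempty a).to_subtype
      have := (h.upperFractions_nonempty b).to_subtype
      conv_rhs => rw [value, value, sInf_eq_iInf', sInf_eq_iInf']
      refine NNReal.le_iInf_add_iInf ?_
      rintro ⟨_, p, q, hq, hpq, rfl⟩ ⟨_, p', q', hq', hpq', rfl⟩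
      refine value_le ⟨p * q' + q * p', q * q', by positivity, ?_, frac_add p q p' q' hq hq'⟩
      have h1 := h.add _ _ _ _ (h.mul_left hpq (q' : S)) (h.mul_left hpq' (q : S))
      have e1 : ((q * q' : ℕ) : S) * (a + b) = q' * (q * a) + q * (q' * b) := by push_cast; ring
      have e2 : ((p * q' + q * p' : ℕ) : S) = q' * p + q * p' := by push_cast; ring
      rwa [e1, e2]
    · have key : ∀ l ∈ lowerFractions le a, ∀ l' ∈ lowerFractions le b,
          l + l' ≤ value le (a + b) := by
        rintro _ ⟨p, q, hq, hpq, rfl⟩ _ ⟨p', q', hq', hpq', rfl⟩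
        refine hlow ⟨p * q' + q * p', q * q', by positivity, ?_, frac_add p q p' q' hq hq'⟩
        have h1 := h.add _ _ _ _ (h.mul_left hpq (q' : S)) (h.mul_left hpq' (q : S))
        have e1 : ((q * q' : ℕ) : S) * (a + b) = q' * (q * a) + q * (q' * b) := by
          push_cast; ring
        have e2 : ((p * q' + q * p' : ℕ) : S) = q' * p + q * p' := by push_cast; ring
        rwa [e1, e2]
      have hb : value le b ≤ value le (a + b) := hmono _ _ (h.le_add_left b a)
      have h1 : value le a ≤ value le (a + b) - value le b := by
        rw [h.value_eq_sSup htot a]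
        refine csSup_le ⟨_, h.zero_mem_lowerFractions a⟩ fun l hl => ?_
        have h2 : value le b ≤ value le (a + b) - l := by
          conv_lhs => rw [h.value_eq_sSup htot b]
          exact csSup_le ⟨_, h.zero_mem_lowerFractions b⟩ fun l' hl' =>
            le_tsub_of_add_le_left (key l hl l' hl')
        have h3 : l ≤ value le (a + b) := by
          simpa using key l hl 0 (h.zero_mem_lowerFractions b)
        exact le_tsub_of_add_le_left ((le_tsub_iff_right h3).1 h2)
      exact (le_tsub_iff_right hb).1 h1
  have hmul : ∀ a b : S, value le (a * b) = value le a * value le b := by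
    intro a b
    have ecomm : ∀ q q' : ℕ, ((q * q' : ℕ) : S) * (a * b) = q * a * (q' * b) := by
      intro q q'
      push_cast
      ring
    apply le_antisymm
    · conv_rhs => rw [value, value, sInf_eq_iInf', sInf_eq_iInf']
      have := (h.upperFractions_nonempty a).to_subtype
      have := (h.upperFractions_nonempty b).to_subtype
      refine NNReal.le_iInf_mul fun u => NNReal.le_mul_iInf fun u' => ?_
      obtain ⟨_, p, q, hq, hpq, rfl⟩ := u
      obtain ⟨_, p', q', hq', hpq', rfl⟩ := u'
      refine value_le ⟨p * p', q * q', by positivity, ?_, frac_mul p q p' q'⟩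
      rw [ecomm, Nat.cast_mul]
      exact h.mul _ _ _ _ hpq hpq'
    · rw [h.value_eq_sSup htot a, h.value_eq_sSup htot b, sSup_eq_iSup', sSup_eq_iSup']
      refine NNReal.iSup_mul_le fun u => NNReal.mul_iSup_le fun u' => ?_
      obtain ⟨_, p, q, hq, hpq, rfl⟩ := u
      obtain ⟨_, p', q', hq', hpq', rfl⟩ := u'
      refine hlow ⟨p * p', q * q', by positivity, ?_, frac_mul p q p' q'⟩
      rw [ecomm, Nat.cast_mul]
      exact h.mul _ _ _ _ hpq hpq'
  exact ⟨{ toFun := value le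
           map_zero' := by simpa using hnat 0
           map_one' := by simpa using hnat 1
           map_add' := hadd
           map_mul' := hmul }, hmono⟩

/-! ### Existence of spectral points and compactness -/

theorem spectrum_nonempty (h : IsStrassenPreorder le) : (spectrum le).Nonempty := by
  obtain ⟨P, hP, hmax⟩ := h.exists_maximal
  obtain ⟨φ, hφ⟩ := exists_mem_spectrum_of_total hmax.prop (le_or_asympLE_of_maximal hmax)
  exact ⟨φ, fun a b hab => hφ a b (hP a b hab)⟩

/-- If `v` is not asymptotically below `u`, some point of the spectrum takes a value at `u` at
most its value at `v`. -/
theorem exists_mem_spectrum_le (h : IsStrassenPreorder le) {u v : S} (hvu : ¬ AsympLE le v u) :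
    ∃ φ ∈ spectrum le, φ u ≤ φ v := by
  obtain ⟨φ, hφ⟩ := (h.extension_isStrassenPreorder hvu).spectrum_nonempty
  exact ⟨φ, fun a b hab => hφ a b (le_extension hab), hφ u v (h.extension_self u v)⟩

theorem apply_le_rank (h : IsStrassenPreorder le) {φ : S →+* NNReal} (hφ : φ ∈ spectrum le)
    (x : S) : φ x ≤ rank le x := by
  simpa using hφ _ _ (h.isLeast_rank x).1

theorem subrank_le_apply (h : IsStrassenPreorder le) {φ : S →+* NNReal} (hφ : φ ∈ spectrum le)
    (x : S) : (subrank le x : NNReal) ≤ φ x := by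
  simpa using hφ _ _ (h.isGreatest_subrank x).1

/-- The set of values of the spectrum at `a` is closed. -/
theorem exists_mem_spectrum_of_tendsto (h : IsStrassenPreorder le) {f : ℕ → S →+* NNReal}
    (hf : ∀ i, f i ∈ spectrum le) {a : S} {c : NNReal}
    (hc : Tendsto (fun i => f i a) atTop (𝓝 c)) : ∃ φ ∈ spectrum le, φ a = c := by
  have hlim : ∀ x : S, ∃ y : NNReal,
      Tendsto (fun i => f i x) (hyperfilter ℕ : Filter ℕ) (𝓝 y) := by
    intro x
    -- All values at `x` lie in the compact interval `[0, rank x]`, so a single ultrafilter gives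
    -- limits at every `x` simultaneously.
    obtain ⟨y, -, hy⟩ := isCompact_Icc.ultrafilter_le_nhds
      ((hyperfilter ℕ).map fun i => f i x) (s := Set.Icc 0 (rank le x : NNReal))
      (tendsto_principal.2 (Eventually.of_forall fun i => ⟨bot_le, h.apply_le_rank (hf i) x⟩))
    exact ⟨y, hy⟩
  choose g hg using hlim
  refine ⟨{ toFun := g
            map_zero' := tendsto_nhds_unique (hg 0) (by simp)
            map_one' := tendsto_nhds_unique (hg 1) (by simp)
            map_add' := fun x y => tendsto_nhds_unique (hg (x + y))
              (by simpa using (hg x).add (hg y))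
            map_mul' := fun x y => tendsto_nhds_unique (hg (x * y))
              (by simpa using (hg x).mul (hg y)) }, fun x y hxy => ?_, ?_⟩
  · exact le_of_tendsto_of_tendsto' (hg x) (hg y) fun i => hf i x y hxy
  · exact tendsto_nhds_unique (hg a) (hc.mono_left Nat.hyperfilter_le_atTop)

end IsStrassenPreorder

/-! ### Integers between powers, and Fekete's lemma -/

/-- For large `N`, `y ^ N > 2 * x ^ N ≥ x ^ N + 1`, which leaves room for an integer. -/
theorem exists_pow_lt_natCast_lt_pow {x y : ℝ} (hx : 1 ≤ x) (hxy : x < y) :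
    ∃ N n : ℕ, N ≠ 0 ∧ x ^ N < n ∧ (n : ℝ) < y ^ N := by
  have hx0 : 0 < x := by linarith
  obtain ⟨N, hN⟩ := pow_unbounded_of_one_lt 2 ((one_lt_div hx0).2 hxy)
  rw [div_pow, lt_div_iff₀ (by positivity)] at hN
  have h1 : 1 ≤ x ^ N := one_le_pow₀ hx
  refine ⟨N, ⌊x ^ N⌋₊ + 1, ?_, by exact_mod_cast Nat.lt_floor_add_one _, ?_⟩
  · rintro rfl
    norm_num at hN
  · have := Nat.floor_le (show 0 ≤ x ^ N by positivity)
    push_cast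
    linarith

/-- Fekete's lemma in multiplicative form. -/
theorem exists_tendsto_rpow_of_submultiplicative {v : ℕ → ℝ} {c : ℝ} (hc : 0 < c)
    (hv : ∀ n, c ^ n ≤ v n) (hmul : ∀ m n, v (m + n) ≤ v m * v n) :
    ∃ R : ℝ, 0 < R ∧ Tendsto (fun N : ℕ => v N ^ (1 / (N : ℝ))) atTop (𝓝 R) ∧
      ∀ N, R ^ N ≤ v N := by
  have hpos : ∀ n, 0 < v n := fun n => (pow_pos hc n).trans_le (hv n)
  have hsub : Subadditive fun n => Real.log (v n) := by
    intro m n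
    rw [← Real.log_mul (hpos m).ne' (hpos n).ne']
    exact Real.log_le_log (hpos _) (hmul m n)
  have hbdd : BddBelow (Set.range fun n : ℕ => Real.log (v n) / n) := by
    -- The 0 covers the term `n = 0`, where division by zero returns 0.
    refine ⟨min (Real.log c) 0, ?_⟩
    rintro _ ⟨n, rfl⟩
    rcases Nat.eq_zero_or_pos n with rfl | hn
    · simp
    · refine (min_le_left _ _).trans ?_
      have hn' : (0 : ℝ) < n := by exact_mod_cast hn
      rw [le_div_iff₀ hn', mul_comm, ← Real.log_pow]
      exact Real.log_le_log (pow_pos hc n) (hv n)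
  refine ⟨Real.exp hsub.lim, Real.exp_pos _, ?_, fun N => ?_⟩
  · refine ((Real.continuous_exp.tendsto _).comp (hsub.tendsto_lim hbdd)).congr fun N => ?_
    rw [Real.rpow_def_of_pos (hpos N), mul_one_div]
    rfl
  · rcases Nat.eq_zero_or_pos N with rfl | hN
    · simpa using hv 0
    · have hN' : (0 : ℝ) < N := by exact_mod_cast hN
      have h1 := hsub.lim_le_div hbdd hN.ne'
      rw [le_div_iff₀ hN'] at h1
      rw [← Real.exp_nat_mul, ← Real.le_log_iff_exp_le (hpos N), mul_comm]
      exact h1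

/-! ### Asymptotic rank and subrank as extreme spectral values -/

namespace IsStrassenPreorder

variable {S : Type*} [CommSemiring S] {le : S → S → Prop}

theorem one_le_pow (h : IsStrassenPreorder le) {a : S} (ha : le 1 a) (N : ℕ) : le 1 (a ^ N) := by
  simpa using h.pow ha N

theorem exists_tendsto_rank (h : IsStrassenPreorder le) {a : S} (ha : le 1 a) :
    ∃ R : ℝ, 0 < R ∧
      Tendsto (fun N : ℕ => (rank le (a ^ N) : ℝ) ^ (1 / (N : ℝ))) atTop (𝓝 R) ∧
      ∀ N, R ^ N ≤ rank le (a ^ N) := by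
  refine exists_tendsto_rpow_of_submultiplicative one_pos (fun n => ?_) fun m n => ?_
  · rw [one_pow]
    have h1 := h.trans _ _ _ (h.one_le_pow ha n) (h.isLeast_rank (a ^ n)).1
    exact_mod_cast (h.natCast_iff 1 (rank le (a ^ n))).2 (by simpa using h1)
  · have h1 := h.mul _ _ _ _ (h.isLeast_rank (a ^ m)).1 (h.isLeast_rank (a ^ n)).1
    rw [← pow_add] at h1
    exact_mod_cast (h.isLeast_rank (a ^ (m + n))).2
      (show le _ ((rank le (a ^ m) * rank le (a ^ n) : ℕ) : S) by exact_mod_cast h1)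

theorem exists_tendsto_subrank (h : IsStrassenPreorder le) {a : S} (ha : le 1 a) :
    ∃ Q : ℝ, 0 < Q ∧
      Tendsto (fun N : ℕ => (subrank le (a ^ N) : ℝ) ^ (1 / (N : ℝ))) atTop (𝓝 Q) ∧
      ∀ N, (subrank le (a ^ N) : ℝ) ≤ Q ^ N := by
  have hone : ∀ n, (1 : ℝ) ≤ subrank le (a ^ n) := fun n => by
    exact_mod_cast (h.isGreatest_subrank (a ^ n)).2
      (show le ((1 : ℕ) : S) (a ^ n) by simpa using h.one_le_pow ha n)
  have hpos : ∀ n, (0 : ℝ) < subrank le (a ^ n) := fun n => one_pos.trans_le (hone n)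
  have hbound : ∀ n, subrank le (a ^ n) ≤ rank le a ^ n := fun n =>
    (h.natCast_iff _ _).2 (by
      push_cast
      exact h.trans _ _ _ (h.isGreatest_subrank (a ^ n)).1 (h.pow (h.isLeast_rank a).1 n))
  have hrank : (0 : ℝ) < rank le a := by
    have h1 : (1 : ℝ) ≤ (rank le a : ℝ) ^ 1 := (hone 1).trans (by exact_mod_cast hbound 1)
    linarith
  -- Subrank is supermultiplicative, so Fekete applies to its reciprocal, bounded below through
  -- `rank le a`.
  obtain ⟨R, hR, hlim, hle⟩ := exists_tendsto_rpow_of_submultiplicative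
    (v := fun n => (subrank le (a ^ n) : ℝ)⁻¹) (inv_pos.2 hrank) (fun n => by
      rw [inv_pow]
      exact inv_anti₀ (hpos n) (by exact_mod_cast hbound n)) (fun m n => by
      rw [← mul_inv]
      refine inv_anti₀ (mul_pos (hpos m) (hpos n)) ?_
      have h1 := h.mul _ _ _ _ (h.isGreatest_subrank (a ^ m)).1 (h.isGreatest_subrank (a ^ n)).1
      rw [← pow_add] at h1
      exact_mod_cast (h.isGreatest_subrank (a ^ (m + n))).2
        (show le ((subrank le (a ^ m) * subrank le (a ^ n) : ℕ) : S) _ by exact_mod_cast h1))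
  refine ⟨R⁻¹, inv_pos.2 hR, (hlim.inv₀ hR.ne').congr fun N => ?_, fun N => ?_⟩
  · rw [Real.inv_rpow (hpos N).le, inv_inv]
  · rw [inv_pow]
    exact le_inv_of_le_inv₀ (pow_pos hR N) (hle N)

/-- Domination would bound the rank of `a ^ (N * M * T)` by `2 ^ M * n ^ (M * T)`; taking `M`-th
roots and letting `T` grow gives `R ^ N ≤ n`. -/
theorem not_asympLE_of_lt_pow (h : IsStrassenPreorder le) {a : S} {R : ℝ} {N n : ℕ}
    (hR : ∀ N, R ^ N ≤ rank le (a ^ N)) (hn : 0 < n) (hnR : (n : ℝ) < R ^ N) :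
    ¬ AsympLE le (a ^ N) (n : S) := by
  intro hle
  have hn' : (0 : ℝ) < n := by exact_mod_cast hn
  refine absurd (le_of_forall_pow_le_mul_pow (C := 2) hn' fun T => ?_) (not_le.2 hnR)
  obtain ⟨M, hM, h1⟩ := hle T
  rw [← pow_mul] at h1
  have h2 : rank le (a ^ (N * (M * T))) ≤ 2 ^ M * n ^ (M * T) :=
    (h.isLeast_rank _).2 (by exact_mod_cast h1)
  have h3 : R ^ (N * (M * T)) ≤ 2 ^ M * (n : ℝ) ^ (M * T) :=
    (hR _).trans (by exact_mod_cast h2)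
  rw [mul_comm M T, ← mul_assoc, pow_mul, pow_mul (n : ℝ), ← mul_pow, pow_mul R] at h3
  exact le_of_pow_le_pow_left₀ hM.ne' (by positivity) h3

/-- Replacing `2 ^ M` by `a ^ (k * M)` turns domination into a subrank bound; after `M`-th roots
only the constant `Q ^ k` remains. -/
theorem not_asympLE_of_pow_lt (h : IsStrassenPreorder le) {a : S} {Q : ℝ} {N n k : ℕ}
    (hQ0 : 0 < Q) (hQ : ∀ N, (subrank le (a ^ N) : ℝ) ≤ Q ^ N) (hk : le 2 (a ^ k))
    (hnQ : Q ^ N < n) : ¬ AsympLE le (n : S) (a ^ N) := by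
  intro hle
  refine absurd (le_of_forall_pow_le_mul_pow (C := Q ^ k) (pow_pos hQ0 N) fun T => ?_)
    (not_le.2 hnQ)
  obtain ⟨M, hM, h1⟩ := hle T
  have h2 := h.trans _ _ _ h1 (h.mul_right (h.pow hk M) ((a ^ N) ^ (M * T)))
  rw [← pow_mul, ← pow_mul, ← pow_add] at h2
  have h3 : n ^ (M * T) ≤ subrank le (a ^ (k * M + N * (M * T))) :=
    (h.isGreatest_subrank _).2 (by exact_mod_cast h2)
  have h4 : (n : ℝ) ^ (M * T) ≤ Q ^ (k * M + N * (M * T)) :=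
    le_trans (by exact_mod_cast h3) (hQ _)
  have e : k * M + N * (M * T) = (k + N * T) * M := by ring
  rw [e, mul_comm M T, pow_mul, pow_mul Q, pow_add, pow_mul Q N T] at h4
  exact le_of_pow_le_pow_left₀ hM.ne' (by positivity) h4

theorem apply_le_of_tendsto_rank (h : IsStrassenPreorder le) {a : S} {R : ℝ}
    (hlim : Tendsto (fun N : ℕ => (rank le (a ^ N) : ℝ) ^ (1 / (N : ℝ))) atTop (𝓝 R))
    {φ : S →+* NNReal} (hφ : φ ∈ spectrum le) : (φ a : ℝ) ≤ R := by
  refine ge_of_tendsto hlim ((eventually_ge_atTop 1).mono fun N hN => ?_)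
  have h1 : (φ a : ℝ) ^ N ≤ rank le (a ^ N) := by
    have := h.apply_le_rank hφ (a ^ N)
    rw [map_pow] at this
    exact_mod_cast this
  rw [one_div]
  exact (Real.le_rpow_inv_iff_of_pos (by positivity) (by positivity)
    (by exact_mod_cast hN)).2 (by simpa using h1)

theorem le_apply_of_tendsto_subrank (h : IsStrassenPreorder le) {a : S} {Q : ℝ}
    (hlim : Tendsto (fun N : ℕ => (subrank le (a ^ N) : ℝ) ^ (1 / (N : ℝ))) atTop (𝓝 Q))
    {φ : S →+* NNReal} (hφ : φ ∈ spectrum le) : Q ≤ (φ a : ℝ) := by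
  refine le_of_tendsto hlim ((eventually_ge_atTop 1).mono fun N hN => ?_)
  have h1 : (subrank le (a ^ N) : ℝ) ≤ (φ a : ℝ) ^ N := by
    have := h.subrank_le_apply hφ (a ^ N)
    rw [map_pow] at this
    exact_mod_cast this
  rw [one_div]
  exact (Real.rpow_inv_le_iff_of_pos (by positivity) (by positivity)
    (by exact_mod_cast hN)).2 (by simpa using h1)

theorem exists_apply_eq_of_tendsto (h : IsStrassenPreorder le) {f : ℕ → S →+* NNReal}
    (hf : ∀ i, f i ∈ spectrum le) {a : S} {c : ℝ} (hc0 : 0 ≤ c)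
    (hc : Tendsto (fun i => (f i a : ℝ)) atTop (𝓝 c)) : ∃ φ ∈ spectrum le, (φ a : ℝ) = c := by
  lift c to NNReal using hc0
  obtain ⟨φ, hφ, hφa⟩ := h.exists_mem_spectrum_of_tendsto hf (NNReal.tendsto_coe.1 hc)
  exact ⟨φ, hφ, by rw [hφa]⟩

theorem exists_apply_eq_of_tendsto_rank (h : IsStrassenPreorder le) {a : S} (ha : le 1 a) {R : ℝ}
    (hlim : Tendsto (fun N : ℕ => (rank le (a ^ N) : ℝ) ^ (1 / (N : ℝ))) atTop (𝓝 R))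
    (hR : ∀ N, R ^ N ≤ rank le (a ^ N)) : ∃ φ ∈ spectrum le, (φ a : ℝ) = R := by
  -- Integers between powers need a base at least 1. If `R ≤ 1`, every `φ` works, since `1 ≤ φ a ≤
  -- R`.
  rcases le_or_gt R 1 with hR1 | hR1
  · obtain ⟨φ, hφ⟩ := h.spectrum_nonempty
    refine ⟨φ, hφ, le_antisymm (h.apply_le_of_tendsto_rank hlim hφ) (hR1.trans ?_)⟩
    have := hφ _ _ ha
    rw [map_one] at this
    exact_mod_cast this
  · obtain ⟨r, -, hr, hrR⟩ := exists_seq_strictMono_tendsto' hR1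
    have hex : ∀ i, ∃ φ ∈ spectrum le, r i ≤ (φ a : ℝ) := by
      intro i
      obtain ⟨N, n, hN, hrn, hnR⟩ := exists_pow_lt_natCast_lt_pow (hr i).1.le (hr i).2
      have hr0 : 0 < r i := one_pos.trans (hr i).1
      have hn : 0 < n := by exact_mod_cast (pow_pos hr0 N).trans hrn
      obtain ⟨φ, hφ, hle⟩ := h.exists_mem_spectrum_le (h.not_asympLE_of_lt_pow hR hn hnR)
      rw [map_natCast, map_pow] at hle
      refine ⟨φ, hφ, le_of_pow_le_pow_left₀ hN (by positivity) (hrn.le.trans ?_)⟩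
      exact_mod_cast hle
    choose φ hφ hle using hex
    exact h.exists_apply_eq_of_tendsto hφ (by linarith) (tendsto_of_tendsto_of_tendsto_of_le_of_le
      hrR tendsto_const_nhds hle fun i => h.apply_le_of_tendsto_rank hlim (hφ i))

theorem exists_apply_eq_of_tendsto_subrank (h : IsStrassenPreorder le) {a : S} (ha : le 1 a)
    {k : ℕ} (hk : le 2 (a ^ k)) {Q : ℝ} (hQ0 : 0 < Q)
    (hlim : Tendsto (fun N : ℕ => (subrank le (a ^ N) : ℝ) ^ (1 / (N : ℝ))) atTop (𝓝 Q))
    (hQ : ∀ N, (subrank le (a ^ N) : ℝ) ≤ Q ^ N) : ∃ φ ∈ spectrum le, (φ a : ℝ) = Q := by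
  have hQ1 : 1 ≤ Q := by
    have h1 : 1 ≤ subrank le (a ^ 1) :=
      (h.isGreatest_subrank _).2 (by simpa using ha)
    have h2 : ((1 : ℕ) : ℝ) ≤ Q ^ 1 := le_trans (by exact_mod_cast h1) (hQ 1)
    simpa using h2
  obtain ⟨r, -, hr, hrQ⟩ := exists_seq_strictAnti_tendsto Q
  have hex : ∀ i, ∃ φ ∈ spectrum le, (φ a : ℝ) ≤ r i := by
    intro i
    obtain ⟨N, n, hN, hQn, hnr⟩ := exists_pow_lt_natCast_lt_pow hQ1 (hr i)
    obtain ⟨φ, hφ, hle⟩ := h.exists_mem_spectrum_le (h.not_asympLE_of_pow_lt hQ0 hQ hk hQn)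
    rw [map_natCast, map_pow] at hle
    refine ⟨φ, hφ, le_of_pow_le_pow_left₀ hN (hQ0.trans (hr i)).le (le_trans ?_ hnr.le)⟩
    exact_mod_cast hle
  choose φ hφ hle using hex
  exact h.exists_apply_eq_of_tendsto hφ hQ0.le (tendsto_of_tendsto_of_tendsto_of_le_of_le
    tendsto_const_nhds hrQ (fun i => h.le_apply_of_tendsto_subrank hlim (hφ i)) hle)

end IsStrassenPreorder

end StrassenPreorder

theorem corollary3p1 {S : Type*} [CommSemiring S] (le : S → S → Prop)
    (hle : StrassenPreorder.IsStrassenPreorder le) :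
    (∀ a : S, le 1 a → (∃ k : ℕ, le 2 (a ^ k)) →
      Tendsto (fun N : ℕ => (StrassenPreorder.subrank le (a ^ N) : ℝ) ^ (1 / (N : ℝ))) atTop
        (𝓝 (StrassenPreorder.asympSubrank le a)) ∧
      IsLeast {x : ℝ | ∃ φ ∈ StrassenPreorder.spectrum le, (φ a : ℝ) = x}
        (StrassenPreorder.asympSubrank le a)) ∧
    (∀ a : S, le 1 a →
      Tendsto (fun N : ℕ => (StrassenPreorder.rank le (a ^ N) : ℝ) ^ (1 / (N : ℝ))) atTop
        (𝓝 (StrassenPreorder.asympRank le a)) ∧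
      IsGreatest {x : ℝ | ∃ φ ∈ StrassenPreorder.spectrum le, (φ a : ℝ) = x}
        (StrassenPreorder.asympRank le a)) := by
  refine ⟨fun a ha ⟨k, hk⟩ => ?_, fun a ha => ?_⟩
  · obtain ⟨Q, hQ0, hlim, hQ⟩ := hle.exists_tendsto_subrank ha
    have e : StrassenPreorder.asympSubrank le a = Q := hlim.limUnder_eq
    rw [e]
    refine ⟨hlim, hle.exists_apply_eq_of_tendsto_subrank ha hk hQ0 hlim hQ, ?_⟩
    rintro _ ⟨φ, hφ, rfl⟩
    exact hle.le_apply_of_tendsto_subrank hlim hφ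
  · obtain ⟨R, -, hlim, hR⟩ := hle.exists_tendsto_rank ha
    have e : StrassenPreorder.asympRank le a = R := hlim.limUnder_eq
    rw [e]
    refine ⟨hlim, hle.exists_apply_eq_of_tendsto_rank ha hlim hR, ?_⟩
    rintro _ ⟨φ, hφ, rfl⟩
    exact hle.apply_le_of_tendsto_rank hlim hφ
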